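/- Let $P$ be a set of $n$ points in general position in the plane (no three collinear), where $n$ is a multiple of $3$, and suppose that $P$ is $3$-decomposable: $P$ can be partitioned into three sets $A,B,C$ of equal size for which there is a triangle $T$ enclosing $P$ such that the orthogonal projections of $P$ onto the three sides of $T$ show $A$ between $B$ and $C$ on one side, $B$ between $A$ and $C$ on another side, and $C$ between $A$ and $B$ on the third side. Let $k\ge 0$ be an integer with $k<n/2$, and let $\chi_{\le k}(P)$ be the number of $(\le k)$-sets of $P$, that is, of nonempty subsets of $P$ with at most $k$ elements that can be separated from the rest of $P$ by a straight line. For real $r$ put $\binom r2=\frac{r(r-1)}2$ if $r\ge 2$ and $\binom r2=0$ if $r<2$. Then $$\chi_{\le k}(P)\;\ge\; B(k,n):=3\binom{k+1}{2}+3\binom{k+1-n/3}{2}+3\sum_{j=2}^{s-1}j(j+1)\binom{k+1-c_jn}{2},$$ where $c_j:=\frac12-\frac1{3j(j+1)}$ and $s=s(k,n)$ is the unique integer such that $$\binom s2<\frac{n}{3(n-2k-1)}\le\binom{s+1}2 .$$ In the extreme case $n=2k+1$ the quotient is read as $+\infty$ and $s=\infty$: the inequality then holds with the sum over all $j\ge2$,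 which has only finitely many nonzero terms (equivalently, with any integer in place of $s$). -/

import Mathlib

noncomputable section

namespace KSets

/-- The Euclidean plane. -/
abbrev Plane : Type := EuclideanSpace ℝ (Fin 2)

/-- General position: no three distinct points of `P` lie on a line. -/
def GeneralPosition (P : Finset Plane) : Prop :=
  ∀ p ∈ P, ∀ q ∈ P, ∀ r ∈ P, p ≠ q → p ≠ r → q ≠ r → ¬ Collinear ℝ {p, q, r}

/-- The orthogonal projection of `p` onto the line through `x` and `y`. -/
def proj (x y p : Plane) : Plane :=
  (EuclideanGeometry.orthogonalProjection (affineSpan ℝ {x, y}) p : Plane)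

/-- The orthogonal projections onto the line through `x` and `y` show `Y` between `X` and `Z`:
every projected point of `Y` is strictly between every projected point of `X` and every
projected point of `Z`. -/
def ShowsBetween (x y : Plane) (X Y Z : Finset Plane) : Prop :=
  ∀ a ∈ X, ∀ b ∈ Y, ∀ c ∈ Z, Sbtw ℝ (proj x y a) (proj x y b) (proj x y c)

/-- `P` is 3-decomposable: it has a partition into three sets `A`, `B`, `C` of equal size, and
there is a (nondegenerate) triangle with vertices `t 0`, `t 1`, `t 2` that encloses `P`, such
that the orthogonal projections of `P` onto the three sides of the triangle show `A` between
`B` and `C` on one side, `B` between `A` and `C` on another side, and `C` between `A` and `B`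
on the third side. -/
def ThreeDecomposable (P : Finset Plane) : Prop :=
  ∃ A B C : Finset Plane,
    A ∪ B ∪ C = P ∧ Disjoint A B ∧ Disjoint A C ∧ Disjoint B C ∧
    A.card = B.card ∧ B.card = C.card ∧
    ∃ t : Fin 3 → Plane,
      AffineIndependent ℝ t ∧ (P : Set Plane) ⊆ convexHull ℝ (Set.range t) ∧
      ShowsBetween (t 1) (t 2) B A C ∧
      ShowsBetween (t 2) (t 0) A B C ∧
      ShowsBetween (t 0) (t 1) A C B

/-- `Q` is separated from the rest of `P` by a straight line, the line `⟪u, x⟫ = c` with `u ≠ 0`: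
`Q` lies in one of the two open half-planes and `P \ Q` in the other. -/
def SeparableByLine (P Q : Finset Plane) : Prop :=
  ∃ (u : Plane) (c : ℝ), u ≠ 0 ∧
    (∀ x ∈ Q, inner ℝ u x < c) ∧ (∀ x ∈ P, x ∉ Q → c < inner ℝ u x)

open Classical in
/-- The (nonempty) `(≤ k)`-sets of `P`: the nonempty subsets of `P` with at most `k` elements
that can be separated from the rest of `P` by a straight line. -/
def leSets (k : ℕ) (P : Finset Plane) : Finset (Finset Plane) :=
  P.powerset.filter fun Q => Q.Nonempty ∧ Q.card ≤ k ∧ SeparableByLine P Q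

/-- The number `χ_{≤ k}(P)` of `(≤ k)`-sets of `P`. -/
def chi (k : ℕ) (P : Finset Plane) : ℕ := (leSets k P).card

/-- The binomial coefficient `r` over `2` for real `r`, with the convention that it is `0`
for `r < 2`. -/
def choose2 (r : ℝ) : ℝ := if r < 2 then 0 else r * (r - 1) / 2

/-- `c_j = 1/2 - 1/(3 j (j + 1))`. -/
def coeff (j : ℤ) : ℝ := 1 / 2 - 1 / (3 * (j : ℝ) * ((j : ℝ) + 1))

/-- `s` satisfies the condition that determines `s(k, n)`, used when `n - 2 k - 1 > 0`. -/
def IsIndex (k n : ℕ) (s : ℤ) : Prop :=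
  choose2 (s : ℝ) < (n : ℝ) / (3 * ((n : ℝ) - 2 * (k : ℝ) - 1)) ∧
    (n : ℝ) / (3 * ((n : ℝ) - 2 * (k : ℝ) - 1)) ≤ choose2 ((s : ℝ) + 1)

/-- The bound `B(k, n)`, as a function of `k`, `n` and the number `s` that bounds the sum. -/
def B (k n : ℕ) (s : ℤ) : ℝ :=
  3 * choose2 ((k : ℝ) + 1) + 3 * choose2 ((k : ℝ) + 1 - (n : ℝ) / 3) +
    3 * ∑ j ∈ Finset.Icc (2 : ℤ) (s - 1),
      (j : ℝ) * ((j : ℝ) + 1) * choose2 ((k : ℝ) + 1 - coeff j * (n : ℝ))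

end KSets

end

/-! Call a pair of points critical if fewer than `k` points lie on one side of its line. Tilting the
line about the midpoint of the pair turns it into a `(≤ k)`-set, injectively for directed pairs
(`card_pairs_le_chi`), so it suffices to count critical pairs.

Each class `X` of `m = n/3` points comes first in some direction. While this direction makes a
half-turn, the point of rank `i` moves to rank `n - 1 - i`, and each swap is a step at a level given
by the line through the two points. Counting only steps at critical levels gives a signed identity
for every point (`sum_sign_crit`). Summed over the first `t` points of `X`, the pairs inside this
prefix cancel. For `t = m` this counts the critical pairs leaving `X` exactly. For `m ≤ k` and `t ≤
m` it shows that the graph of non-critical pairs in `X` has at most `d * t` edges between the prefix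
and the rest of `X`, where `d = n - 2k - 1`.

Such a graph has few edges: cut the list into blocks, count all pairs inside blocks and use the cut
bound between them. Optimal block sizes increase by `d`, and `N + 1` blocks match the first `N`
terms of the sum extended to start at `j = 1` (`edges_add_sum_le`). Hence the bound holds for every
`s`. -/

noncomputable section

namespace KSets

/-! ### Signed rank changes and listings by a key. -/

open Finset in
/-- The rank changes of a point that passes the points of `S` one after another, in the order of
`φ`, add up to the difference of its final and its initial rank. -/
theorem sum_rank_steps {α : Type*} [DecidableEq α] (φ : α → ℝ) (pos : α → Prop)
    [DecidablePred pos] (S : Finset α) (hφ : Set.InjOn φ S) (g : ℕ → ℝ) :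
    ∑ q ∈ S, (if pos q then (1 : ℝ) else -1) *
      (g (#{x ∈ S | (pos x ∧ φ x < φ q) ∨ (¬ pos x ∧ φ q < φ x)} + 1) -
        g #{x ∈ S | (pos x ∧ φ x < φ q) ∨ (¬ pos x ∧ φ q < φ x)}) =
      g #{x ∈ S | pos x} - g #{x ∈ S | ¬ pos x} := by
  induction S using Finset.induction_on_max_value φ generalizing g with
  | empty => simp
  | insert a s ha hmax ih =>
    have hlt : ∀ x ∈ s, φ x < φ a := fun x hx => lt_of_le_of_ne (hmax x hx) fun h => ha <| by
      have := hφ (by simp [hx]) (by simp) h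
      rwa [← this]
    have hinj : Set.InjOn φ s := hφ.mono (by simp)
    rw [sum_insert ha]
    -- The point `a` has the largest key, so it is passed last, when exactly the points with `pos`
    -- rank below.
    have hself : {x ∈ insert a s | (pos x ∧ φ x < φ a) ∨ (¬ pos x ∧ φ a < φ x)} =
        {x ∈ s | pos x} := by
      ext x
      simp only [mem_filter, mem_insert]
      constructor
      · rintro ⟨rfl | hx, h⟩
        · simp at h
        · rcases h with h | h
          · exact ⟨hx, h.1⟩
          · exact absurd h.2 (hlt x hx).not_gt
      · rintro ⟨hx, h⟩
        exact ⟨Or.inr hx, Or.inl ⟨h, hlt x hx⟩⟩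
    rw [hself]
    by_cases hp : pos a
    · have hrest : ∀ q ∈ s, {x ∈ insert a s | (pos x ∧ φ x < φ q) ∨ (¬ pos x ∧ φ q < φ x)} =
          {x ∈ s | (pos x ∧ φ x < φ q) ∨ (¬ pos x ∧ φ q < φ x)} := by
        intro q hq
        rw [filter_insert, if_neg]
        simp [hp, (hlt q hq).le]
      rw [sum_congr rfl fun q hq => by rw [hrest q hq], ih hinj g, filter_insert, if_pos hp,
        if_pos hp, filter_insert, if_neg (not_not.2 hp), card_insert_of_notMem (by simp [ha])]
      ring
    -- Passed last, `a` stays in front until then and raises every earlier rank by one; the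
    -- induction therefore needs arbitrary `g`.
    · have hrest : ∀ q ∈ s, #{x ∈ insert a s | (pos x ∧ φ x < φ q) ∨ (¬ pos x ∧ φ q < φ x)} =
          #{x ∈ s | (pos x ∧ φ x < φ q) ∨ (¬ pos x ∧ φ q < φ x)} + 1 := by
        intro q hq
        rw [filter_insert, if_pos (Or.inr ⟨hp, hlt q hq⟩), card_insert_of_notMem (by simp [ha])]
      rw [sum_congr rfl fun q hq => by rw [hrest q hq], ih hinj fun i => g (i + 1), filter_insert,
        if_neg hp, filter_insert, if_pos hp, card_insert_of_notMem (by simp [ha])]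
      simp only [hp, if_false]
      ring

/-- A finite set with an injective key can be listed in increasing order of the key. -/
theorem exists_increasing_list {α : Type*} [Nonempty α] [DecidableEq α] (κ : α → ℝ) (X : Finset α)
    (hκ : Set.InjOn κ X) :
    ∃ f : ℕ → α, (∀ i < X.card, ∀ j < X.card, i < j → κ (f i) < κ (f j)) ∧
      (Finset.range X.card).image f = X := by
  induction X using Finset.induction_on_max_value κ with
  | empty => exact ⟨fun _ => Classical.arbitrary α, by simp, by simp⟩
  | insert a s ha hmax ih =>
    obtain ⟨f, hf, him⟩ := ih (hκ.mono (by simp))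
    have hlt : ∀ x ∈ s, κ x < κ a := fun x hx => lt_of_le_of_ne (hmax x hx) fun h => ha <| by
      have := hκ (by simp [hx]) (by simp) h
      rwa [← this]
    have hmem : ∀ i < s.card, f i ∈ s := fun i hi => by
      rw [← him]; exact Finset.mem_image_of_mem f (Finset.mem_range.2 hi)
    refine ⟨fun i => if i < s.card then f i else a, ?_, ?_⟩
    · rw [Finset.card_insert_of_notMem ha]
      intro i hi j hj hij
      have hi' : i < s.card := by omega
      by_cases hj' : j < s.card
      · simpa [hi', hj'] using hf i hi' j hj' hij
      · simpa [hi', hj'] using hlt _ (hmem i hi')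
    · rw [Finset.card_insert_of_notMem ha, Finset.range_add_one, Finset.image_insert]
      simp only [lt_irrefl, if_false]
      congr 1
      refine Eq.trans (Finset.image_congr fun i hi => ?_) him
      exact if_pos (by simpa using hi)

/-! ### Edge bounds for graphs with small prefix cuts. -/

/-- In a graph on `0, …, m - 1` in which every initial segment of length `t` sends at most `d * t`
edges to its complement, the number of edges is bounded through any division into blocks. -/
theorem edges_le_blocks (e : ℕ → ℕ → ℝ) (m : ℕ) (d : ℝ) (h0 : ∀ i j, 0 ≤ e i j)
    (h1 : ∀ i j, e i j ≤ 1)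
    (hcut : ∀ t ≤ m, ∑ i ∈ Finset.range t, ∑ j ∈ Finset.Ico t m, e i j ≤ d * t)
    (b t : ℕ → ℕ) (ht0 : t 0 = 0) (ht : ∀ i, t (i + 1) = t i + b i) (s : ℕ) (hs : t s ≤ m) :
    ∑ j ∈ Finset.range (t s), ∑ i ∈ Finset.range j, e i j ≤
      ∑ i ∈ Finset.range s, ((b i : ℝ) * (b i - 1) / 2 + d * t i) := by
  induction s with
  | zero => simp [ht0]
  | succ s ih =>
    have hle : t s ≤ m := by rw [ht] at hs; omega
    rw [Finset.sum_range_succ]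
    have hsplit := Finset.sum_range_add_sum_Ico (fun j => ∑ i ∈ Finset.range j, e i j)
      (show t s ≤ t (s + 1) by rw [ht]; omega)
    rw [← hsplit]
    refine add_le_add (ih hle) ?_
    -- Edges from a vertex of the new block back to earlier blocks belong to the cut at `t s`;
    -- inside the block all pairs are allowed.
    have hinner : ∀ j ∈ Finset.Ico (t s) (t (s + 1)), ∑ i ∈ Finset.range j, e i j ≤
        ∑ i ∈ Finset.range (t s), e i j + ((j - t s : ℕ) : ℝ) := by
      intro j hj
      rw [Finset.mem_Ico] at hj
      rw [← Finset.sum_range_add_sum_Ico (fun i => e i j) hj.1]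
      gcongr
      calc ∑ i ∈ Finset.Ico (t s) j, e i j ≤ ∑ i ∈ Finset.Ico (t s) j, (1 : ℝ) :=
            Finset.sum_le_sum fun i _ => h1 i j
        _ = _ := by simp
    refine (Finset.sum_le_sum hinner).trans ?_
    rw [Finset.sum_add_distrib, Finset.sum_comm, add_comm]
    refine add_le_add (le_of_eq ?_) (le_trans ?_ (hcut _ hle))
    · rw [Finset.sum_Ico_eq_sum_range, ht]
      simp only [add_tsub_cancel_left]
      induction b s with
      | zero => simp
      | succ c ihc => rw [Finset.sum_range_succ, ihc]; push_cast; ring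
    · exact Finset.sum_le_sum fun i _ => Finset.sum_le_sum_of_subset_of_nonneg
        (Finset.Ico_subset_Ico le_rfl hs) fun j _ _ => h0 i j

/-- Evaluates the bound of `edges_le_blocks` for block sizes `c i + d * i`. -/
theorem sum_blocks (c : ℕ → ℝ) (d : ℝ) (s : ℕ) :
    ∑ i ∈ Finset.range s, ((c i + d * i) * (c i + d * i - 1) / 2 +
        d * (∑ q ∈ Finset.range i, c q + d * (i * (i - 1) / 2))) =
      (∑ i ∈ Finset.range s, c i ^ 2) / 2 -
        (∑ i ∈ Finset.range s, c i + d * (s * (s - 1) / 2)) / 2 +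
        d * (s - 1) * ∑ i ∈ Finset.range s, c i + d ^ 2 * (s * (s - 1) * (4 * s - 5) / 12) := by
  induction s with
  | zero => simp
  | succ s ih =>
    rw [Finset.sum_range_succ, ih, Finset.sum_range_succ (fun i => c i ^ 2),
      Finset.sum_range_succ c]
    push_cast
    ring

/-- Almost equal integer parts. -/
def part (M s i : ℕ) : ℕ := M / s + if i < M % s then 1 else 0

theorem sum_part {M s : ℕ} (hs : 0 < s) : ∑ i ∈ Finset.range s, part M s i = M := by
  simp only [part, Finset.sum_add_distrib, Finset.sum_const, Finset.card_range, smul_eq_mul,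
    Finset.sum_boole, Nat.cast_id]
  have : (Finset.range s).filter (fun i => i < M % s) = Finset.range (M % s) := by
    ext i
    simp only [Finset.mem_filter, Finset.mem_range]
    have := Nat.mod_lt M hs
    omega
  rw [this, Finset.card_range, Nat.div_add_mod]

/-- The parts take only the two values `w` and `w + 1`, where their square is a linear function; the
slack is then a completed square. -/
theorem sum_part_sq_le {M s : ℕ} (hs : 0 < s) :
    ∑ i ∈ Finset.range s, (part M s i : ℝ) ^ 2 ≤ (M : ℝ) ^ 2 / s + s / 4 := by
  have hsq : ∀ i, (part M s i : ℝ) ^ 2 =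
      (2 * ((M / s : ℕ) : ℝ) + 1) * part M s i - ((M / s : ℕ) : ℝ) * (((M / s : ℕ) : ℝ) + 1) := by
    intro i
    unfold part
    split_ifs <;> push_cast <;> ring
  have hsum : ∑ i ∈ Finset.range s, (part M s i : ℝ) = M := by
    exact_mod_cast sum_part hs
  simp only [hsq, Finset.sum_sub_distrib, ← Finset.mul_sum, hsum, Finset.sum_const,
    Finset.card_range, nsmul_eq_mul]
  have hs' : (0 : ℝ) < s := by exact_mod_cast hs
  generalize ((M / s : ℕ) : ℝ) = w
  have key : (M : ℝ) ^ 2 / s + s / 4 - ((2 * w + 1) * M - s * (w * (w + 1))) =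
      (M - s * (2 * w + 1) / 2) ^ 2 / s := by
    field_simp
    ring
  have := div_nonneg (sq_nonneg ((M : ℝ) - s * (2 * w + 1) / 2)) hs'.le
  linarith

/-- The optimal division into `s ≥ 2` blocks, in closed form. -/
theorem edges_le_closed (e : ℕ → ℕ → ℝ) (m d : ℕ) (h0 : ∀ i j, 0 ≤ e i j)
    (h1 : ∀ i j, e i j ≤ 1)
    (hcut : ∀ t ≤ m, ∑ i ∈ Finset.range t, ∑ j ∈ Finset.Ico t m, e i j ≤ (d : ℝ) * t)
    (s M : ℕ) (hs : 2 ≤ s) (hM : (M : ℝ) + d * ((s : ℝ) * (s - 1) / 2) = m) :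
    ∑ j ∈ Finset.range m, ∑ i ∈ Finset.range j, e i j ≤
      (m : ℝ) ^ 2 / (2 * s) + m * d * (s - 1) / 2 - m / 2 -
        ((d : ℝ) ^ 2 - 1) * ((s - 1) * s * (s + 1)) / 24 := by
  have hs0 : 0 < s := by omega
  -- A vertex of block `i` costs its block size plus `d` for each later block, so at the optimum
  -- consecutive sizes differ by `d`.
  set b : ℕ → ℕ := fun i => part M s i + d * i with hb
  set t : ℕ → ℕ := fun i => ∑ q ∈ Finset.range i, b q with htdef
  have htcast : ∀ i, (t i : ℝ) =
      ∑ q ∈ Finset.range i, (part M s q : ℝ) + d * (i * (i - 1) / 2) := by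
    intro i
    induction i with
    | zero => simp [htdef]
    | succ i ih =>
      have : t (i + 1) = t i + b i := Finset.sum_range_succ _ _
      rw [this, Finset.sum_range_succ]
      push_cast [ih, hb]
      ring
  have hsum : ∑ i ∈ Finset.range s, (part M s i : ℝ) = M := by
    exact_mod_cast sum_part hs0
  have hts : t s = m := by
    have : (t s : ℝ) = m := by rw [htcast, hsum, hM]
    exact_mod_cast this
  have key := edges_le_blocks e m d h0 h1 hcut b t (by simp [htdef])
    (fun i => Finset.sum_range_succ _ _) s hts.le
  rw [hts] at key
  refine key.trans ?_
  have heq : ∑ i ∈ Finset.range s, ((b i : ℝ) * (b i - 1) / 2 + d * t i) = _ :=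
    (Finset.sum_congr rfl fun i _ => by rw [htcast]; simp [hb]).trans
      (sum_blocks (fun i => (part M s i : ℝ)) d s)
  rw [heq, hsum]
  have hsq := sum_part_sq_le (M := M) hs0
  have hM' : (M : ℝ) = m - d * ((s : ℝ) * (s - 1) / 2) := by linarith
  have hs' : (2 : ℝ) ≤ s := by exact_mod_cast hs
  -- This is the slack of the closed form after the rounding loss `s / 4`; it needs `s ≥ 2`.
  have h3 : (0 : ℝ) ≤ s * ((s : ℝ) ^ 2 - 4) / 24 := by
    have : (0 : ℝ) ≤ (s : ℝ) ^ 2 - 4 := by nlinarith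
    positivity
  have hfin : (m : ℝ) ^ 2 / (2 * s) + m * d * (s - 1) / 2 - m / 2 -
        ((d : ℝ) ^ 2 - 1) * ((s - 1) * s * (s + 1)) / 24 -
      (((M : ℝ) ^ 2 / s + s / 4) / 2 - (M + d * ((s : ℝ) * (s - 1) / 2)) / 2 + d * (s - 1) * M +
        (d : ℝ) ^ 2 * (s * (s - 1) * (4 * s - 5) / 12)) = s * ((s : ℝ) ^ 2 - 4) / 24 := by
    rw [hM']
    have : (s : ℝ) ≠ 0 := by positivity
    field_simp
    ring
  linarith

/-! ### Orientations, and the passage from pairs to `(≤ k)`-sets. -/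

/-- The orientation determinant of three points. -/
def det (p q x : Plane) : ℝ := (q 0 - p 0) * (x 1 - p 1) - (q 1 - p 1) * (x 0 - p 0)

theorem plane_inner (u x : Plane) : inner ℝ u x = u 0 * x 0 + u 1 * x 1 := by
  simp [PiLp.inner_apply, Fin.sum_univ_two, mul_comm]

theorem plane_ext {p q : Plane} (h0 : p 0 = q 0) (h1 : p 1 = q 1) : p = q := by
  ext i
  fin_cases i
  · exact h0
  · exact h1

theorem sq_pos_of_plane_ne {p q : Plane} (h : p ≠ q) :
    0 < (q 0 - p 0) ^ 2 + (q 1 - p 1) ^ 2 := by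
  by_contra hn
  have h0 : q 0 - p 0 = 0 := by nlinarith [sq_nonneg (q 0 - p 0), sq_nonneg (q 1 - p 1)]
  have h1 : q 1 - p 1 = 0 := by nlinarith [sq_nonneg (q 0 - p 0), sq_nonneg (q 1 - p 1)]
  exact h (plane_ext (by linarith) (by linarith))

theorem GeneralPosition.det_ne_zero {P : Finset Plane} (hP : GeneralPosition P) {p q r : Plane}
    (hp : p ∈ P) (hq : q ∈ P) (hr : r ∈ P) (hpq : p ≠ q) (hpr : p ≠ r) (hqr : q ≠ r) :
    det p q r ≠ 0 := by
  intro h0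
  refine hP p hp q hq r hr hpq hpr hqr ?_
  rw [collinear_iff_of_mem (p₀ := p) (by simp)]
  have hpos := sq_pos_of_plane_ne hpq
  refine ⟨q - p, ?_⟩
  rintro x (rfl | rfl | rfl)
  · exact ⟨0, by simp⟩
  · exact ⟨1, by simp⟩
  -- The coefficient of the orthogonal projection of `x - p` onto `q - p`.
  · refine ⟨((q 0 - p 0) * (x 0 - p 0) + (q 1 - p 1) * (x 1 - p 1)) /
      ((q 0 - p 0) ^ 2 + (q 1 - p 1) ^ 2), ?_⟩
    unfold det at h0
    apply plane_ext
    · simp only [vadd_eq_add, PiLp.add_apply, PiLp.smul_apply, PiLp.sub_apply, smul_eq_mul]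
      rw [div_mul_eq_mul_div, ← sub_eq_iff_eq_add, eq_div_iff hpos.ne']
      linear_combination -(q 1 - p 1) * h0
    · simp only [vadd_eq_add, PiLp.add_apply, PiLp.smul_apply, PiLp.sub_apply, smul_eq_mul]
      rw [div_mul_eq_mul_div, ← sub_eq_iff_eq_add, eq_div_iff hpos.ne']
      linear_combination (q 0 - p 0) * h0

theorem det_swap (p q x : Plane) : det q p x = -det p q x := by
  unfold det; ring

@[simp] theorem det_self_left (p q : Plane) : det p q p = 0 := by unfold det; ring

@[simp] theorem det_self_right (p q : Plane) : det p q q = 0 := by unfold det; ring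

/-- The points of `P` on the right of the directed line from `p` to `q`. -/
def rightSet (P : Finset Plane) (p q : Plane) : Finset Plane := P.filter fun x => det p q x < 0

theorem mem_rightSet {P : Finset Plane} {p q x : Plane} :
    x ∈ rightSet P p q ↔ x ∈ P ∧ det p q x < 0 := Finset.mem_filter

/-- The number of points of `P` on the right of the directed line from `p` to `q`. -/
def rightCount (P : Finset Plane) (p q : Plane) : ℕ := (rightSet P p q).card

theorem GeneralPosition.rightCount_add {P : Finset Plane} (hP : GeneralPosition P) {p q : Plane}
    (hp : p ∈ P) (hq : q ∈ P) (hpq : p ≠ q) : rightCount P p q + rightCount P q p + 2 = P.card := by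
  have hdisj : Disjoint (rightSet P p q) (rightSet P q p) := by
    rw [Finset.disjoint_left]
    intro x hx hx'
    rw [mem_rightSet] at hx hx'
    rw [det_swap] at hx'
    linarith [hx.2, hx'.2]
  have hdisj2 : Disjoint (rightSet P p q ∪ rightSet P q p) {p, q} := by
    rw [Finset.disjoint_right]
    simp [mem_rightSet]
  have hunion : rightSet P p q ∪ rightSet P q p ∪ {p, q} = P := by
    ext x
    simp only [Finset.mem_union, mem_rightSet, Finset.mem_insert, Finset.mem_singleton]
    constructor
    · rintro ((h | h) | rfl | rfl)
      exacts [h.1, h.1, hp, hq]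
    · intro hx
      by_cases h1 : x = p
      · exact Or.inr (Or.inl h1)
      by_cases h2 : x = q
      · exact Or.inr (Or.inr h2)
      left
      rcases lt_or_gt_of_ne (hP.det_ne_zero hp hq hx hpq (Ne.symm h1) (Ne.symm h2)) with h | h
      · exact Or.inl ⟨hx, h⟩
      · exact Or.inr ⟨hx, by rw [det_swap]; linarith⟩
  rw [← Finset.card_pair hpq, rightCount, rightCount, ← Finset.card_union_of_disjoint hdisj,
    ← Finset.card_union_of_disjoint hdisj2, hunion]

/-- The position of `x` in the direction from `p` to `q`, measured from their midpoint. -/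
def along (p q x : Plane) : ℝ :=
  (q 0 - p 0) * (x 0 - (p 0 + q 0) / 2) + (q 1 - p 1) * (x 1 - (p 1 + q 1) / 2)

/-- A slight turn of the line about the midpoint of `p` and `q` puts `p` on the right and `q` on the
left; all other points keep their sides, being off the line. -/
theorem GeneralPosition.separable_insert_rightSet {P : Finset Plane} (hP : GeneralPosition P)
    {p q : Plane} (hp : p ∈ P) (hq : q ∈ P) (hpq : p ≠ q) :
    SeparableByLine P (insert p (rightSet P p q)) := by
  have hpos := sq_pos_of_plane_ne hpq
  have hcont : ∀ x : Plane, Filter.Tendsto (fun t : ℝ => det p q x + t * along p q x)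
      (nhdsWithin 0 (Set.Ioi 0)) (nhds (det p q x)) := by
    intro x
    apply tendsto_nhdsWithin_of_tendsto_nhds
    refine Continuous.tendsto' (by fun_prop) _ _ (by simp)
  have hev : ∀ᶠ t : ℝ in nhdsWithin 0 (Set.Ioi 0), ∀ x ∈ P,
      (det p q x < 0 → det p q x + t * along p q x < 0) ∧
      (0 < det p q x → 0 < det p q x + t * along p q x) := by
    rw [Filter.eventually_all_finset]
    intro x _
    refine Filter.Eventually.and ?_ ?_
    · by_cases h : det p q x < 0
      · filter_upwards [(hcont x).eventually_lt_const h] with t ht _ using ht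
      · exact Filter.Eventually.of_forall fun t h' => absurd h' h
    · by_cases h : 0 < det p q x
      · filter_upwards [(hcont x).eventually_const_lt h] with t ht _ using ht
      · exact Filter.Eventually.of_forall fun t h' => absurd h' h
  obtain ⟨t, ht, ht0⟩ := (hev.and self_mem_nhdsWithin).exists
  have ht0 : 0 < t := ht0
  set u : Plane := !₂[-(q 1 - p 1) + t * (q 0 - p 0), (q 0 - p 0) + t * (q 1 - p 1)] with hu
  have hval : ∀ x : Plane, inner ℝ u x = (det p q x + t * along p q x) +
      (-(q 1 - p 1) * p 0 + (q 0 - p 0) * p 1 +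
        t * ((q 0 - p 0) * ((p 0 + q 0) / 2) + (q 1 - p 1) * ((p 1 + q 1) / 2))) := by
    intro x
    rw [plane_inner]
    simp only [hu, det, along, PiLp.toLp_apply, Matrix.cons_val_zero, Matrix.cons_val_one]
    ring
  have hneg : ∀ x ∈ insert p (rightSet P p q), det p q x + t * along p q x < 0 := by
    intro x hx
    rw [Finset.mem_insert, mem_rightSet] at hx
    rcases hx with rfl | hx
    · rw [det_self_left]
      unfold along
      nlinarith [mul_pos ht0 hpos]
    · exact (ht x hx.1).1 hx.2
  have hposi : ∀ x ∈ P, x ∉ insert p (rightSet P p q) → 0 < det p q x + t * along p q x := by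
    intro x hx hxn
    rw [Finset.mem_insert, mem_rightSet] at hxn
    push Not at hxn
    by_cases hxq : x = q
    · subst hxq
      rw [det_self_right]
      unfold along
      nlinarith [mul_pos ht0 hpos]
    · exact (ht x hx).2 (lt_of_le_of_ne (hxn.2 hx)
        (hP.det_ne_zero hp hq hx hpq (Ne.symm hxn.1) (Ne.symm hxq)).symm)
  refine ⟨u, -(q 1 - p 1) * p 0 + (q 0 - p 0) * p 1 +
    t * ((q 0 - p 0) * ((p 0 + q 0) / 2) + (q 1 - p 1) * ((p 1 + q 1) / 2)),
    ?_, fun x hx => ?_, fun x hx hxn => ?_⟩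
  · intro h0
    have h1 := hneg p (by simp)
    have h2 := hposi q hq (by simp [Ne.symm hpq, mem_rightSet])
    have e1 := hval p
    have e2 := hval q
    simp only [h0, inner_zero_left] at e1 e2
    linarith
  · rw [hval]; linarith [hneg x hx]
  · rw [hval]; linarith [hposi x hx hxn]

/-- The cross product of `q - p` and `q' - p'` is nonnegative by one separation and nonpositive by
the other. So `p'` and `q'` lie on the line through `p` and `q`, and general position identifies
them. -/
theorem GeneralPosition.insert_rightSet_injective {P : Finset Plane} (hP : GeneralPosition P)
    {p q p' q' : Plane} (hp : p ∈ P) (hq : q ∈ P) (hpq : p ≠ q) (hp' : p' ∈ P) (hq' : q' ∈ P)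
    (hpq' : p' ≠ q') (h : insert p (rightSet P p q) = insert p' (rightSet P p' q')) :
    p = p' ∧ q = q' := by
  have hle : ∀ p q : Plane, ∀ x ∈ insert p (rightSet P p q), det p q x ≤ 0 := by
    intro p q x hx
    rw [Finset.mem_insert, mem_rightSet] at hx
    rcases hx with rfl | hx
    · simp
    · exact hx.2.le
  have hge : ∀ p q : Plane, ∀ x ∈ P, x ∉ insert p (rightSet P p q) → 0 ≤ det p q x := by
    intro p q x hx hxn
    rw [Finset.mem_insert, mem_rightSet] at hxn
    push Not at hxn
    exact hxn.2 hx
  have hnot : ∀ p q : Plane, p ≠ q → q ∉ insert p (rightSet P p q) := by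
    intro p q hpq
    simp [Ne.symm hpq, mem_rightSet]
  have a1 : det p q p' ≤ 0 := hle p q p' (by simp [h])
  have a2 : 0 ≤ det p q q' := hge p q q' hq' (by rw [h]; exact hnot _ _ hpq')
  have a3 : det p' q' p ≤ 0 := hle p' q' p (by simp [← h])
  have a4 : 0 ≤ det p' q' q := hge p' q' q hq (by rw [← h]; exact hnot _ _ hpq)
  have hsum : det p q q' - det p q p' = -(det p' q' q - det p' q' p) := by
    unfold det; ring
  have z1 : det p q p' = 0 := by linarith
  have z2 : det p q q' = 0 := by linarith
  have hpp : p' = p := by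
    by_contra hne
    by_cases hqp : p' = q
    · exact hnot p q hpq (by rw [h, ← hqp]; simp)
    · exact hP.det_ne_zero hp hq hp' hpq (Ne.symm hne) (Ne.symm hqp) z1
  refine ⟨hpp.symm, ?_⟩
  by_contra hne
  exact hP.det_ne_zero hp hq hq' hpq (hpp ▸ hpq') hne z2

/-- Distinct ordered pairs with fewer than `k` points on their right give distinct
`(≤ k)`-sets. -/
theorem GeneralPosition.card_pairs_le_chi {P : Finset Plane} (hP : GeneralPosition P) (k : ℕ) :
    (P.offDiag.filter fun x => rightCount P x.1 x.2 < k).card ≤ chi k P := by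
  refine Finset.card_le_card_of_injOn (fun x => insert x.1 (rightSet P x.1 x.2)) ?_ ?_
  · rintro ⟨p, q⟩ hx
    simp only [Finset.coe_filter, Finset.mem_offDiag, Set.mem_ofPred_eq] at hx
    obtain ⟨⟨hp, hq, hpq⟩, hk⟩ := hx
    simp only [leSets, Finset.coe_filter, Set.mem_ofPred_eq, Finset.mem_powerset]
    refine ⟨?_, by simp, ?_, hP.separable_insert_rightSet hp hq hpq⟩
    · exact Finset.insert_subset hp (Finset.filter_subset _ _)
    · exact (Finset.card_insert_le _ _).trans hk
  · rintro ⟨p, q⟩ hx ⟨p', q'⟩ hx' h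
    simp only [Finset.coe_filter, Finset.mem_offDiag, Set.mem_ofPred_eq] at hx hx'
    obtain ⟨h1, h2⟩ := hP.insert_rightSet_injective hx.1.1 hx.1.2.1 hx.1.2.2 hx'.1.1 hx'.1.2.1
      hx'.1.2.2 h
    rw [h1, h2]

/-- The indicator of the pairs that have fewer than `k` points on one of their sides. -/
def crit (P : Finset Plane) (k : ℕ) (p q : Plane) : ℝ :=
  if rightCount P p q < k ∨ rightCount P q p < k then 1 else 0

theorem crit_comm (P : Finset Plane) (k : ℕ) (p q : Plane) : crit P k p q = crit P k q p := by
  simp only [crit, or_comm]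

theorem crit_nonneg (P : Finset Plane) (k : ℕ) (p q : Plane) : 0 ≤ crit P k p q := by
  unfold crit; split_ifs <;> norm_num

theorem crit_le_one (P : Finset Plane) (k : ℕ) (p q : Plane) : crit P k p q ≤ 1 := by
  unfold crit; split_ifs <;> norm_num

/-- A critical pair has fewer than `k` points on its right in at least one direction, and the sum
counts it twice. -/
theorem GeneralPosition.sum_crit_le_chi {P : Finset Plane} (hP : GeneralPosition P) (k : ℕ) :
    ∑ p ∈ P, ∑ q ∈ P.erase p, crit P k p q ≤ 2 * chi k P := by
  set D : ℝ := ∑ x ∈ P.offDiag, if rightCount P x.1 x.2 < k then (1 : ℝ) else 0 with hD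
  have hDchi : D ≤ chi k P := by
    rw [hD, Finset.sum_boole]
    exact_mod_cast hP.card_pairs_le_chi k
  have hD' : D = ∑ x ∈ P.offDiag, if rightCount P x.2 x.1 < k then (1 : ℝ) else 0 := by
    refine Finset.sum_nbij' Prod.swap Prod.swap ?_ ?_ ?_ ?_ ?_ <;>
      simp +contextual [Finset.mem_offDiag, eq_comm]
  have hoff : ∑ p ∈ P, ∑ q ∈ P.erase p, crit P k p q = ∑ x ∈ P.offDiag, crit P k x.1 x.2 := by
    rw [Finset.sum_sigma']
    refine Finset.sum_nbij' (fun x => (x.1, x.2)) (fun x => ⟨x.1, x.2⟩) ?_ ?_ ?_ ?_ ?_ <;>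
      simp +contextual [Finset.mem_offDiag, eq_comm]
  rw [hoff]
  calc ∑ x ∈ P.offDiag, crit P k x.1 x.2 ≤ D + D := by
        nth_rewrite 2 [hD']
        rw [hD, ← Finset.sum_add_distrib]
        refine Finset.sum_le_sum fun x _ => ?_
        unfold crit
        split_ifs <;> first | tauto | norm_num
    _ ≤ 2 * chi k P := by linarith

/-! ### The half-turn and the critical steps of one point. -/

/-- A function of the rank that increases by one exactly on the first and last `k` steps. -/
def clampRank (k n r : ℕ) : ℝ := min (r : ℝ) k + max (r : ℝ) ((n : ℝ) - k - 1)

/-- Here `l' < k` means `l ≥ n - k - 1`; the hypothesis `2 * k + 1 ≤ n` keeps the two ranges of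
increase disjoint. -/
theorem clampRank_step {k n l l' : ℕ} (hk : 2 * k + 1 ≤ n) (hl : l + l' + 2 = n) :
    clampRank k n (l + 1) - clampRank k n l = if l < k ∨ l' < k then 1 else 0 := by
  have hn : (n : ℝ) = l + l' + 2 := by exact_mod_cast hl.symm
  unfold clampRank
  push_cast
  by_cases h1 : l < k
  · have h2 : k + 1 ≤ l' + 1 := by omega
    have h1' : (l : ℝ) + 1 ≤ k := by exact_mod_cast h1
    have h2' : (k : ℝ) + 1 ≤ l' + 1 := by exact_mod_cast h2
    rw [if_pos (Or.inl h1), min_eq_left h1', min_eq_left (by linarith), max_eq_right (by linarith),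
      max_eq_right (by linarith)]
    ring
  · have h1' : (k : ℝ) ≤ l := by exact_mod_cast not_lt.1 h1
    rw [min_eq_right (by linarith), min_eq_right h1']
    by_cases h2 : l' < k
    · have h2' : (l' : ℝ) + 1 ≤ k := by exact_mod_cast h2
      rw [if_pos (Or.inr h2), max_eq_left (by linarith), max_eq_left (by linarith)]
      ring
    · have h2' : (k : ℝ) ≤ l' := by exact_mod_cast not_lt.1 h2
      rw [if_neg (by tauto), max_eq_right (by linarith), max_eq_right (by linarith)]
      ring

theorem clampRank_diff {k m i : ℕ} (hk : 2 * k + 1 ≤ 3 * m) (hi : i < m) :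
    clampRank k (3 * m) (3 * m - 1 - i) - clampRank k (3 * m) i = 2 * (k - min (i : ℝ) k) := by
  have hc : ((3 * m - 1 - i : ℕ) : ℝ) = 3 * m - 1 - i := by
    rw [Nat.sub_sub, Nat.cast_sub (by omega)]
    push_cast
    ring
  have hk' : (2 : ℝ) * k + 1 ≤ 3 * m := by exact_mod_cast hk
  have hi' : (i : ℝ) + 1 ≤ m := by exact_mod_cast hi
  have hi0 : (0 : ℝ) ≤ i := by positivity
  unfold clampRank
  rw [hc]
  push_cast
  rw [min_eq_right (show (k : ℝ) ≤ 3 * m - 1 - i by linarith),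
    max_eq_right (show (i : ℝ) ≤ 3 * m - k - 1 by linarith)]
  rcases le_total (i : ℝ) k with h | h
  · rw [max_eq_left (by linarith), min_eq_left h]; ring
  · rw [max_eq_right (by linarith), min_eq_right h]; ring

/-- The left side is the determinant of `q - a` and `x - a` in coordinates along `u` and its
quarter-turn. -/
theorem inner_sub_mul_det (u a q x : Plane) :
    (u 0 * (q 0 - a 0) + u 1 * (q 1 - a 1)) * (-u 1 * (x 0 - a 0) + u 0 * (x 1 - a 1)) -
      (-u 1 * (q 0 - a 0) + u 0 * (q 1 - a 1)) * (u 0 * (x 0 - a 0) + u 1 * (x 1 - a 1)) =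
    (u 0 ^ 2 + u 1 ^ 2) * det a q x := by
  unfold det; ring

/-- The slope of the direction from `a` to `q` with respect to the axis `u`. -/
def slope (u a q : Plane) : ℝ :=
  (-u 1 * (q 0 - a 0) + u 0 * (q 1 - a 1)) / (inner ℝ u q - inner ℝ u a)

theorem slope_sub_slope {u a q x : Plane} (hq : (inner ℝ u q : ℝ) - inner ℝ u a ≠ 0)
    (hx : (inner ℝ u x : ℝ) - inner ℝ u a ≠ 0) :
    slope u a x - slope u a q = (u 0 ^ 2 + u 1 ^ 2) * det a q x /
      (((inner ℝ u q : ℝ) - inner ℝ u a) * (inner ℝ u x - inner ℝ u a)) := by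
  rw [← inner_sub_mul_det, slope, slope, div_sub_div _ _ hx hq]
  simp only [plane_inner]
  congr 1 <;> ring

open Finset in
/-- Rotating the direction `u` by a half-turn reverses the rank of `a`, and every other point
contributes one step to the change. -/
theorem GeneralPosition.sum_sign_crit {P : Finset Plane} (hP : GeneralPosition P) {k : ℕ}
    (hk : 2 * k + 1 ≤ P.card) {u a : Plane} (hu : Set.InjOn (fun x => (inner ℝ u x : ℝ)) P)
    (ha : a ∈ P) :
    ∑ q ∈ P.erase a, (if (inner ℝ u a : ℝ) < inner ℝ u q then (1 : ℝ) else -1) * crit P k a q =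
      clampRank k P.card #{x ∈ P.erase a | (inner ℝ u a : ℝ) < inner ℝ u x} -
        clampRank k P.card #{x ∈ P.erase a | ¬ (inner ℝ u a : ℝ) < inner ℝ u x} := by
  have hne : ∀ q ∈ P.erase a, (inner ℝ u q : ℝ) - inner ℝ u a ≠ 0 := by
    intro q hq h
    rw [mem_erase] at hq
    exact hq.1 (hu hq.2 ha (sub_eq_zero.1 h))
  rcases (P.erase a).eq_empty_or_nonempty with hemp | ⟨q₀, hq₀⟩
  · simp [hemp]
  have hupos : 0 < u 0 ^ 2 + u 1 ^ 2 := by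
    by_contra hn
    have h0 : u 0 = 0 := by nlinarith [sq_nonneg (u 0), sq_nonneg (u 1)]
    have h1 : u 1 = 0 := by nlinarith [sq_nonneg (u 0), sq_nonneg (u 1)]
    apply hne q₀ hq₀
    simp [plane_inner, h0, h1]
  have hdet : ∀ q ∈ P.erase a, ∀ x ∈ P.erase a, q ≠ x → det a q x ≠ 0 := by
    intro q hq x hx hqx
    rw [mem_erase] at hq hx
    exact hP.det_ne_zero ha hq.2 hx.2 (Ne.symm hq.1) (Ne.symm hx.1) hqx
  have hinj : Set.InjOn (slope u a) (P.erase a : Finset Plane) := by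
    intro q hq x hx h
    by_contra hqx
    have := slope_sub_slope (hne q hq) (hne x hx)
    rw [h, sub_self, eq_comm, div_eq_zero_iff] at this
    rcases this with h | h
    · exact mul_ne_zero hupos.ne' (hdet q hq x hx hqx) h
    · exact mul_ne_zero (hne q hq) (hne x hx) h
  -- Slopes increase in the order in which the rotating direction swaps `a` with the other points.
  -- At the swap with `q`, the points before both lie on one side of their line, so the level is a
  -- `rightCount`.
  rw [← sum_rank_steps (slope u a) (fun x => (inner ℝ u a : ℝ) < inner ℝ u x) (P.erase a) hinj]
  refine sum_congr rfl fun q hq => ?_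
  congr 1
  have hqP := mem_erase.1 hq
  have hadd := hP.rightCount_add ha hqP.2 (Ne.symm hqP.1)
  have hlt : ∀ x ∈ P.erase a, (slope u a x < slope u a q ↔
      det a q x / (((inner ℝ u q : ℝ) - inner ℝ u a) * (inner ℝ u x - inner ℝ u a)) < 0) := by
    intro x hx
    rw [← sub_neg, slope_sub_slope (hne q hq) (hne x hx), mul_div_assoc]
    exact ⟨fun h => by by_contra hn; exact absurd h (not_lt.2 (mul_nonneg hupos.le (not_lt.1 hn))),
      fun h => mul_neg_of_pos_of_neg hupos h⟩
  have hgt : ∀ x ∈ P.erase a, (slope u a q < slope u a x ↔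
      0 < det a q x / (((inner ℝ u q : ℝ) - inner ℝ u a) * (inner ℝ u x - inner ℝ u a))) := by
    intro x hx
    rw [← sub_pos, slope_sub_slope (hne q hq) (hne x hx), mul_div_assoc]
    exact mul_pos_iff_of_pos_left hupos
  by_cases hpos : (inner ℝ u a : ℝ) < inner ℝ u q
  · have hlevel : {x ∈ P.erase a | ((inner ℝ u a : ℝ) < inner ℝ u x ∧ slope u a x < slope u a q) ∨
        (¬ (inner ℝ u a : ℝ) < inner ℝ u x ∧ slope u a q < slope u a x)} = rightSet P a q := by
      ext x
      rw [mem_filter, mem_rightSet]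
      constructor
      · rintro ⟨hx, h⟩
        refine ⟨(mem_erase.1 hx).2, ?_⟩
        rw [hlt x hx, hgt x hx] at h
        by_contra hd
        rcases h with ⟨h1, h2⟩ | ⟨h1, h2⟩
        · exact absurd h2 (not_lt.2 (div_nonneg (not_lt.1 hd)
            (mul_nonneg (by linarith) (by linarith))))
        · exact absurd h2 (not_lt.2 (div_nonpos_of_nonneg_of_nonpos (not_lt.1 hd)
            (mul_nonpos_of_nonneg_of_nonpos (by linarith) (by linarith))))
      · rintro ⟨hx, hd⟩
        have hxa : x ∈ P.erase a := mem_erase.2 ⟨by rintro rfl; simp at hd, hx⟩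
        refine ⟨hxa, ?_⟩
        rw [hlt x hxa, hgt x hxa]
        have hnx := hne x hxa
        by_cases h1 : (inner ℝ u a : ℝ) < inner ℝ u x
        · exact Or.inl ⟨h1, div_neg_of_neg_of_pos hd (mul_pos (by linarith) (by linarith))⟩
        · have : (inner ℝ u x : ℝ) - inner ℝ u a < 0 :=
            lt_of_le_of_ne (by linarith) hnx
          exact Or.inr ⟨h1, div_pos_of_neg_of_neg hd (mul_neg_of_pos_of_neg (by linarith) this)⟩
    rw [hlevel]
    exact (clampRank_step hk hadd).symm
  · have hq' : (inner ℝ u q : ℝ) - inner ℝ u a < 0 := lt_of_le_of_ne (by linarith) (hne q hq)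
    have hlevel : {x ∈ P.erase a | ((inner ℝ u a : ℝ) < inner ℝ u x ∧ slope u a x < slope u a q) ∨
        (¬ (inner ℝ u a : ℝ) < inner ℝ u x ∧ slope u a q < slope u a x)} = rightSet P q a := by
      ext x
      rw [mem_filter, mem_rightSet, det_swap, neg_lt_zero]
      constructor
      · rintro ⟨hx, h⟩
        refine ⟨(mem_erase.1 hx).2, ?_⟩
        rw [hlt x hx, hgt x hx] at h
        by_contra hd
        rcases h with ⟨h1, h2⟩ | ⟨h1, h2⟩
        · exact absurd h2 (not_lt.2 (div_nonneg_of_nonpos (not_lt.1 hd)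
            (mul_nonpos_of_nonpos_of_nonneg hq'.le (by linarith))))
        · exact absurd h2 (not_lt.2 (div_nonpos_of_nonpos_of_nonneg (not_lt.1 hd)
            (mul_nonneg_of_nonpos_of_nonpos hq'.le (by linarith))))
      · rintro ⟨hx, hd⟩
        have hxa : x ∈ P.erase a := mem_erase.2 ⟨by rintro rfl; simp at hd, hx⟩
        refine ⟨hxa, ?_⟩
        rw [hlt x hxa, hgt x hxa]
        have hnx := hne x hxa
        by_cases h1 : (inner ℝ u a : ℝ) < inner ℝ u x
        · exact Or.inl ⟨h1, div_neg_of_pos_of_neg hd (mul_neg_of_neg_of_pos hq' (by linarith))⟩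
        · have : (inner ℝ u x : ℝ) - inner ℝ u a < 0 :=
            lt_of_le_of_ne (by linarith) hnx
          exact Or.inr ⟨h1, div_pos hd (mul_pos_of_neg_of_neg hq' this)⟩
    rw [hlevel, crit_comm]
    exact (clampRank_step hk (by omega)).symm

/-! ### Prefix cuts, and the edge bound against the terms of `B`. -/

/-- In a symmetric array, the differences of the row parts after and before the diagonal add up
to the block that links an initial segment with its complement. -/
theorem sum_after_sub_before (c : ℕ → ℕ → ℝ) (hc : ∀ i j, c i j = c j i) {m t : ℕ} (ht : t ≤ m) :
    ∑ i ∈ Finset.range t, (∑ j ∈ Finset.Ico (i + 1) m, c i j - ∑ j ∈ Finset.range i, c i j) =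
      ∑ i ∈ Finset.range t, ∑ j ∈ Finset.Ico t m, c i j := by
  induction t with
  | zero => simp
  | succ t ih =>
    rw [Finset.sum_range_succ, ih (by omega), Finset.sum_range_succ]
    -- Column `t` leaves the cut and, by symmetry, cancels the part of row `t` before the diagonal.
    have : ∀ i, ∑ j ∈ Finset.Ico t m, c i j = c i t + ∑ j ∈ Finset.Ico (t + 1) m, c i j :=
      fun i => Finset.sum_eq_sum_Ico_succ_bot (by omega) _
    simp only [this, Finset.sum_add_distrib, hc t]
    ring

/-- Replaces `k` by the cut parameter `d`; the index is shifted so that `j = 0` stands for `c_1 =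
1/3`. -/
theorem coeff_term (k m d j : ℕ) (hk : d + 2 * k + 1 = 3 * m) :
    (k : ℝ) + 1 - coeff ((j : ℤ) + 1) * ((3 * m : ℕ) : ℝ) =
      (m : ℝ) / (((j : ℝ) + 1) * (j + 2)) - d / 2 + 1 / 2 := by
  have hk' : (k : ℝ) = (3 * m - d - 1) / 2 := by
    have : (d : ℝ) + 2 * k + 1 = 3 * m := by exact_mod_cast hk
    linarith
  rw [coeff, hk']
  push_cast
  have h1 : (j : ℝ) + 1 ≠ 0 := by positivity
  have h2 : (j : ℝ) + 2 ≠ 0 := by positivity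
  have h3 : (j : ℝ) + 1 + 1 ≠ 0 := by positivity
  field_simp
  ring

/-- Without the cutoff of `choose2` the sum is explicit, and it complements the bound of
`edges_le_closed` for `N + 1` blocks to exactly `m * (m - 1) / 2`. -/
theorem sum_closed (m d : ℝ) (N : ℕ) :
    ∑ j ∈ Finset.range N, ((j : ℝ) + 1) * (j + 2) *
      ((m / (((j : ℝ) + 1) * (j + 2)) - d / 2 + 1 / 2) *
        (m / (((j : ℝ) + 1) * (j + 2)) - d / 2 + 1 / 2 - 1) / 2) =
      m ^ 2 / 2 - m ^ 2 / (2 * (N + 1)) - m * d * N / 2 +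
        (d ^ 2 - 1) * (N * (N + 1) * (N + 2)) / 24 := by
  induction N with
  | zero => simp
  | succ N ih =>
    rw [Finset.sum_range_succ, ih]
    have h1 : (N : ℝ) + 1 ≠ 0 := by positivity
    have h2 : (N : ℝ) + 2 ≠ 0 := by positivity
    have h3 : (N : ℝ) + 1 + 1 ≠ 0 := by positivity
    push_cast
    field_simp
    ring

/-- The number of edges, together with the terms of the sum in `B`, is at most the number of
pairs. -/
theorem edges_add_sum_le (e : ℕ → ℕ → ℝ) (m d k : ℕ) (h0 : ∀ i j, 0 ≤ e i j)
    (h1 : ∀ i j, e i j ≤ 1)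
    (hcut : ∀ t ≤ m, ∑ i ∈ Finset.range t, ∑ j ∈ Finset.Ico t m, e i j ≤ (d : ℝ) * t)
    (hk : d + 2 * k + 1 = 3 * m) (N : ℕ) :
    ∑ j ∈ Finset.range m, ∑ i ∈ Finset.range j, e i j +
      ∑ j ∈ Finset.range N, ((j : ℝ) + 1) * (j + 2) *
        choose2 ((k : ℝ) + 1 - coeff ((j : ℤ) + 1) * ((3 * m : ℕ) : ℝ)) ≤
      (m : ℝ) * (m - 1) / 2 := by
  simp only [coeff_term k m d _ hk]
  induction N with
  | zero =>
    rw [Finset.sum_range_zero, add_zero]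
    calc ∑ j ∈ Finset.range m, ∑ i ∈ Finset.range j, e i j
        ≤ ∑ j ∈ Finset.range m, ∑ i ∈ Finset.range j, (1 : ℝ) :=
          Finset.sum_le_sum fun j _ => Finset.sum_le_sum fun i _ => h1 i j
      _ = (m : ℝ) * (m - 1) / 2 := by
          simp only [Finset.sum_const, Finset.card_range, nsmul_eq_mul, mul_one]
          clear hk hcut
          induction m with
          | zero => simp
          | succ m ih => rw [Finset.sum_range_succ, ih]; push_cast; ring
  | succ N ih =>
    -- A vanishing last term adds nothing. Otherwise the earlier arguments are at least as large,
    -- and no cutoff is active.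
    by_cases hlast : (m : ℝ) / (((N : ℝ) + 1) * (N + 2)) - d / 2 + 1 / 2 < 2
    · rw [Finset.sum_range_succ, choose2, if_pos hlast, mul_zero, add_zero]
      exact ih
    · have hlast' := not_lt.1 hlast
      have hterm : ∀ j ∈ Finset.range (N + 1),
          choose2 ((m : ℝ) / (((j : ℝ) + 1) * (j + 2)) - d / 2 + 1 / 2) =
          (m / (((j : ℝ) + 1) * (j + 2)) - d / 2 + 1 / 2) *
            (m / (((j : ℝ) + 1) * (j + 2)) - d / 2 + 1 / 2 - 1) / 2 := by
        intro j hj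
        have hj' : (j : ℝ) ≤ N := by
          exact_mod_cast Nat.lt_succ_iff.1 (Finset.mem_range.1 hj)
        have : (m : ℝ) / (((N : ℝ) + 1) * (N + 2)) ≤ m / (((j : ℝ) + 1) * (j + 2)) := by
          gcongr
        rw [choose2, if_neg]
        linarith
      have hsum : ∑ j ∈ Finset.range (N + 1), ((j : ℝ) + 1) * (j + 2) *
          choose2 ((m : ℝ) / (((j : ℝ) + 1) * (j + 2)) - d / 2 + 1 / 2) = _ :=
        (Finset.sum_congr rfl fun j hj => by rw [hterm j hj]).trans (sum_closed m d (N + 1))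
      rw [hsum]
      -- A nonzero last term leaves room for `N + 2` blocks with sizes growing by `d`.
      have hmd : (d : ℝ) * ((N + 2).choose 2 : ℕ) ≤ m := by
        have hpos : (0 : ℝ) < ((N : ℝ) + 1) * (N + 2) := by positivity
        have : ((d : ℝ) / 2) * (((N : ℝ) + 1) * (N + 2)) ≤ m := by
          rw [← le_div_iff₀ hpos]; linarith
        rw [Nat.cast_choose_two]
        push_cast
        linarith
      have hmd' : d * (N + 2).choose 2 ≤ m := by exact_mod_cast hmd
      have hclosed := edges_le_closed e m d h0 h1 hcut (N + 2) (m - d * (N + 2).choose 2)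
        (by omega) (by
          rw [Nat.cast_sub hmd', Nat.cast_mul, Nat.cast_choose_two]
          ring)
      push_cast at hclosed ⊢
      have e1 : (m : ℝ) ^ 2 / (2 * ((N : ℝ) + 2)) = m ^ 2 / (2 * ((N : ℝ) + 1 + 1)) := by
        congr 2; ring
      rw [e1] at hclosed
      linarith

/-! ### From projections on the triangle's sides to directions. -/

theorem inner_proj (x y p : Plane) : (inner ℝ (y - x) (proj x y p) : ℝ) = inner ℝ (y - x) p := by
  have h := EuclideanGeometry.vsub_orthogonalProjection_mem_direction_orthogonal
    (affineSpan ℝ {x, y}) p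
  rw [Submodule.mem_orthogonal] at h
  have h2 := h (y - x) (by
    rw [direction_affineSpan]
    exact vsub_rev_mem_vectorSpan_pair ℝ x y)
  rw [vsub_eq_sub, inner_sub_right] at h2
  unfold proj
  linarith

theorem sbtw_proj_inner {x y a b c : Plane} (h : Sbtw ℝ (proj x y a) (proj x y b) (proj x y c)) :
    ((inner ℝ (y - x) a : ℝ) < inner ℝ (y - x) b ∧ (inner ℝ (y - x) b : ℝ) < inner ℝ (y - x) c) ∨
    ((inner ℝ (y - x) c : ℝ) < inner ℝ (y - x) b ∧
      (inner ℝ (y - x) b : ℝ) < inner ℝ (y - x) a) := by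
  have hac := h.left_ne_right
  rw [sbtw_iff_mem_image_Ioo_and_ne] at h
  obtain ⟨⟨t, ht, hb⟩, -⟩ := h
  have hdir : proj x y c - proj x y a ∈ (affineSpan ℝ {x, y}).direction :=
    AffineSubspace.vsub_mem_direction (EuclideanGeometry.orthogonalProjection_mem c)
      (EuclideanGeometry.orthogonalProjection_mem a)
  rw [direction_affineSpan, mem_vectorSpan_pair_rev] at hdir
  obtain ⟨r, hr⟩ := hdir
  rw [vsub_eq_sub] at hr
  have hrw : r • (y - x) ≠ 0 := by rw [hr]; exact sub_ne_zero.2 hac.symm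
  have hr0 : r ≠ 0 := fun h0 => hrw (by simp [h0])
  have hw : 0 < (inner ℝ (y - x) (y - x) : ℝ) :=
    real_inner_self_pos.2 fun h0 => hrw (by simp [h0])
  have hc' : (inner ℝ (y - x) c : ℝ) = inner ℝ (y - x) a + r * inner ℝ (y - x) (y - x) := by
    rw [← inner_proj x y c, ← inner_proj x y a, ← inner_smul_right, hr, inner_sub_right]
    ring
  have hb' : (inner ℝ (y - x) b : ℝ) =
      inner ℝ (y - x) a + t * (r * inner ℝ (y - x) (y - x)) := by
    rw [← inner_proj x y b, ← hb, AffineMap.lineMap_apply, vsub_eq_sub, vadd_eq_add, ← hr,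
      inner_add_right, inner_smul_right, inner_smul_right, inner_proj]
    ring
  rw [hb', hc']
  rcases lt_or_gt_of_ne hr0 with h | h
  · right
    have := mul_neg_of_neg_of_pos h hw
    constructor <;> nlinarith [ht.1, ht.2]
  · left
    have := mul_pos h hw
    constructor <;> nlinarith [ht.1, ht.2]

/-- Betweenness leaves the orientation of each triple open; comparison with one fixed triple,
changing points one at a time, makes it uniform. -/
theorem ShowsBetween.exists_direction {x y : Plane} {X Y Z : Finset Plane}
    (h : ShowsBetween x y X Y Z) (hX : X.Nonempty) (hY : Y.Nonempty) (hZ : Z.Nonempty) :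
    ∃ u : Plane, u ≠ 0 ∧ (∀ a ∈ X, ∀ b ∈ Y, (inner ℝ u a : ℝ) < inner ℝ u b) ∧
      (∀ b ∈ Y, ∀ c ∈ Z, (inner ℝ u b : ℝ) < inner ℝ u c) := by
  obtain ⟨a₀, ha₀⟩ := hX
  obtain ⟨b₀, hb₀⟩ := hY
  obtain ⟨c₀, hc₀⟩ := hZ
  have key := fun a ha b hb c hc => sbtw_proj_inner (h a ha b hb c hc)
  rcases key a₀ ha₀ b₀ hb₀ c₀ hc₀ with h0 | h0
  · refine ⟨y - x, ?_, fun a ha b hb => ?_, fun b hb c hc => ?_⟩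
    · intro hz; simp [hz] at h0
    · rcases key a ha b₀ hb₀ c₀ hc₀ with h1 | h1
      · rcases key a ha b hb c₀ hc₀ with h2 | h2 <;> linarith [h0.1, h0.2, h1.1, h1.2, h2.1, h2.2]
      · linarith [h0.1, h0.2, h1.1, h1.2]
    · rcases key a₀ ha₀ b₀ hb₀ c hc with h1 | h1
      · rcases key a₀ ha₀ b hb c hc with h2 | h2 <;> linarith [h0.1, h0.2, h1.1, h1.2, h2.1, h2.2]
      · linarith [h0.1, h0.2, h1.1, h1.2]
  · refine ⟨-(y - x), ?_, fun a ha b hb => ?_, fun b hb c hc => ?_⟩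
    · intro hz; rw [neg_eq_zero] at hz; simp [hz] at h0
    · rw [inner_neg_left, inner_neg_left, neg_lt_neg_iff]
      rcases key a ha b₀ hb₀ c₀ hc₀ with h1 | h1
      · linarith [h0.1, h0.2, h1.1, h1.2]
      · rcases key a ha b hb c₀ hc₀ with h2 | h2 <;> linarith [h0.1, h0.2, h1.1, h1.2, h2.1, h2.2]
    · rw [inner_neg_left, inner_neg_left, neg_lt_neg_iff]
      rcases key a₀ ha₀ b₀ hb₀ c hc with h1 | h1
      · linarith [h0.1, h0.2, h1.1, h1.2]
      · rcases key a₀ ha₀ b hb c hc with h2 | h2 <;> linarith [h0.1, h0.2, h1.1, h1.2, h2.1, h2.2]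

/-- A direction in which `X` precedes `Y` can be tilted so that it distinguishes the points
of `P`. -/
theorem exists_generic_direction (P X Y : Finset Plane) {u : Plane} (hu : u ≠ 0)
    (h : ∀ x ∈ X, ∀ y ∈ Y, (inner ℝ u x : ℝ) < inner ℝ u y) :
    ∃ v : Plane, Set.InjOn (fun x => (inner ℝ v x : ℝ)) P ∧
      ∀ x ∈ X, ∀ y ∈ Y, (inner ℝ v x : ℝ) < inner ℝ v y := by
  set w : Plane := !₂[-u 1, u 0] with hw
  have hcont : ∀ x y : Plane, Filter.Tendsto
      (fun t : ℝ => (inner ℝ (u + t • w) y : ℝ) - inner ℝ (u + t • w) x)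
      (nhdsWithin 0 (Set.Ioi 0)) (nhds (inner ℝ u y - inner ℝ u x)) := by
    intro x y
    apply tendsto_nhdsWithin_of_tendsto_nhds
    refine Continuous.tendsto' (by fun_prop) _ _ (by simp)
  have h1 : ∀ᶠ t : ℝ in nhdsWithin 0 (Set.Ioi 0), ∀ x ∈ X, ∀ y ∈ Y,
      (inner ℝ (u + t • w) x : ℝ) < inner ℝ (u + t • w) y := by
    rw [Filter.eventually_all_finset]
    intro x hx
    rw [Filter.eventually_all_finset]
    intro y hy
    filter_upwards [(hcont x y).eventually_const_lt (sub_pos.2 (h x hx y hy))] with t ht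
    exact sub_pos.1 ht
  have h2 : ∀ᶠ t : ℝ in nhdsWithin 0 (Set.Ioi 0), ∀ x ∈ P, ∀ y ∈ P, x ≠ y →
      (inner ℝ (u + t • w) x : ℝ) ≠ inner ℝ (u + t • w) y := by
    rw [Filter.eventually_all_finset]
    intro x _
    rw [Filter.eventually_all_finset]
    intro y _
    by_cases hz : (inner ℝ u y : ℝ) - inner ℝ u x = 0
    · filter_upwards [self_mem_nhdsWithin] with t ht hxy heq
      have ht : 0 < t := ht
      rw [inner_add_left, inner_add_left, inner_smul_left, inner_smul_left] at heq
      simp only [conj_trivial] at heq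
      have hz' : (inner ℝ w y : ℝ) - inner ℝ w x = 0 := by
        have : t * ((inner ℝ w y : ℝ) - inner ℝ w x) = 0 := by linarith
        exact (mul_eq_zero.1 this).resolve_left ht.ne'
      have hu2 := sq_pos_of_plane_ne hu
      have hxy2 := sq_pos_of_plane_ne hxy
      rw [plane_inner, plane_inner] at hz hz'
      simp only [hw, PiLp.toLp_apply, Matrix.cons_val_zero, Matrix.cons_val_one] at hz'
      simp only [PiLp.zero_apply, zero_sub] at hu2
      -- Since `u` and `w` are orthogonal of equal length, `y - x` cannot be orthogonal to both.
      have hprod : (u 0 ^ 2 + u 1 ^ 2) * ((y 0 - x 0) ^ 2 + (y 1 - x 1) ^ 2) = 0 := by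
        linear_combination (u 0 * (y 0 - x 0) + u 1 * (y 1 - x 1)) * hz +
          (-u 1 * (y 0 - x 0) + u 0 * (y 1 - x 1)) * hz'
      have hne : u 0 ^ 2 + u 1 ^ 2 ≠ 0 := by nlinarith
      exact mul_ne_zero hne hxy2.ne' hprod
    · filter_upwards [(hcont x y).eventually_ne hz] with t ht _ heq
      exact ht (by rw [heq, sub_self])
  obtain ⟨t, ht1, ht2⟩ := (h1.and h2).exists
  exact ⟨u + t • w, fun x hx y hy hxy => by_contra fun hne => ht2 x hx y hy hne hxy, ht1⟩

/-! ### Critical pairs of a single class. -/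

open Finset in
/-- The critical pairs of a class `X` that is first in some direction: those that leave `X` are
counted exactly, those inside `X` are bounded from below. -/
theorem GeneralPosition.crit_sums_of_first {P : Finset Plane} (hP : GeneralPosition P) {k m : ℕ}
    (hPm : P.card = 3 * m) (hk : 2 * k + 1 ≤ 3 * m) {X : Finset Plane} (hXP : X ⊆ P)
    (hXm : X.card = m) {u : Plane} (hu : Set.InjOn (fun x => (inner ℝ u x : ℝ)) P)
    (hfirst : ∀ x ∈ X, ∀ y ∈ P \ X, (inner ℝ u x : ℝ) < inner ℝ u y) :
    ∑ p ∈ X, ∑ q ∈ P \ X, crit P k p q = ∑ i ∈ range m, 2 * ((k : ℝ) - min (i : ℝ) k) ∧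
    (m ≤ k → ∀ N : ℕ, 2 * ∑ j ∈ range N, ((j : ℝ) + 1) * (j + 2) *
        choose2 ((k : ℝ) + 1 - coeff ((j : ℤ) + 1) * ((3 * m : ℕ) : ℝ)) ≤
      ∑ p ∈ X, ∑ q ∈ X.erase p, crit P k p q) := by
  obtain ⟨f, hmono, him⟩ := exists_increasing_list (fun x => (inner ℝ u x : ℝ)) X
    (hu.mono (by exact_mod_cast hXP))
  rw [hXm] at hmono him
  have hfX : ∀ i < m, f i ∈ X := fun i hi => by
    rw [← him]; exact mem_image_of_mem f (mem_range.2 hi)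
  have hlt : ∀ i < m, ∀ j < m, ((inner ℝ u (f i) : ℝ) < inner ℝ u (f j) ↔ i < j) := by
    intro i hi j hj
    refine ⟨fun h => ?_, hmono i hi j hj⟩
    by_contra hn
    rcases (not_lt.1 hn).lt_or_eq with h' | h'
    · exact absurd h (hmono j hj i hi h').not_gt
    · rw [h'] at h; exact lt_irrefl _ h
  have hinj : ∀ i < m, ∀ j < m, f i = f j → i = j := by
    intro i hi j hj h
    rcases lt_trichotomy i j with h' | h' | h'
    · exact absurd (hmono i hi j hj h') (by rw [h]; exact lt_irrefl _)
    · exact h'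
    · exact absurd (hmono j hj i hi h') (by rw [h]; exact lt_irrefl _)
  have hsumX : ∀ F : Plane → ℝ, ∑ q ∈ X, F q = ∑ i ∈ range m, F (f i) := by
    intro F
    conv_lhs => rw [← him]
    exact sum_image fun i hi j hj h => hinj i (by simpa using hi) j (by simpa using hj) h
  have hsplit : ∀ i < m, ∀ F : ℕ → ℝ, ∑ j ∈ range m, F j =
      ∑ j ∈ range i, F j + F i + ∑ j ∈ Ico (i + 1) m, F j := by
    intro i hi F
    rw [← sum_range_succ, sum_range_add_sum_Ico _ (by omega)]
  have hsumErase : ∀ i < m, ∀ F : Plane → ℝ, ∑ q ∈ X.erase (f i), F q =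
      ∑ j ∈ range i, F (f j) + ∑ j ∈ Ico (i + 1) m, F (f j) := by
    intro i hi F
    have h1 := sum_erase_add X F (hfX i hi)
    rw [hsumX, hsplit i hi] at h1
    linarith
  have hPerase : ∀ i < m, ∀ F : Plane → ℝ, ∑ q ∈ P.erase (f i), F q =
      ∑ q ∈ X.erase (f i), F q + ∑ q ∈ P \ X, F q := by
    intro i hi F
    have h1 := sum_erase_add P F (hXP (hfX i hi))
    have h2 := sum_erase_add X F (hfX i hi)
    have h3 := sum_sdiff (f := F) hXP
    linarith
  -- The half-turn identity for `f i`: exactly the `i` points listed earlier in `X` carry the sign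
  -- `-1`.
  have hrow : ∀ i < m, (∑ j ∈ Ico (i + 1) m, crit P k (f i) (f j) -
      ∑ j ∈ range i, crit P k (f i) (f j)) + ∑ q ∈ P \ X, crit P k (f i) q =
      2 * ((k : ℝ) - min (i : ℝ) k) := by
    intro i hi
    have hfi := hfX i hi
    have hbefore : #{x ∈ P.erase (f i) | ¬ (inner ℝ u (f i) : ℝ) < inner ℝ u x} = i := by
      have : {x ∈ P.erase (f i) | ¬ (inner ℝ u (f i) : ℝ) < inner ℝ u x} =
          (range i).image f := by
        ext x
        simp only [mem_filter, mem_erase, mem_image, mem_range]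
        constructor
        · rintro ⟨⟨hne, hx⟩, hnot⟩
          have hxX : x ∈ X := by
            by_contra hxX
            exact hnot (hfirst _ hfi x (mem_sdiff.2 ⟨hx, hxX⟩))
          rw [← him, mem_image] at hxX
          obtain ⟨j, hj, rfl⟩ := hxX
          rw [mem_range] at hj
          rw [hlt i hi j hj] at hnot
          have : j ≠ i := fun h => hne (by rw [h])
          exact ⟨j, by omega, rfl⟩
        · rintro ⟨j, hj, rfl⟩
          have hjm : j < m := by omega
          refine ⟨⟨fun h => ?_, hXP (hfX j hjm)⟩, ?_⟩
          · have := hinj j hjm i hi h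
            omega
          · rw [hlt i hi j hjm]; omega
      rw [this, card_image_of_injOn, card_range]
      intro a ha b hb h
      have ha' : a < i := by simpa using ha
      have hb' : b < i := by simpa using hb
      exact hinj a (by omega) b (by omega) h
    have hafter : #{x ∈ P.erase (f i) | (inner ℝ u (f i) : ℝ) < inner ℝ u x} =
        3 * m - 1 - i := by
      have := card_filter_add_card_filter_not (s := P.erase (f i))
        (fun x => (inner ℝ u (f i) : ℝ) < inner ℝ u x)
      rw [hbefore, card_erase_of_mem (hXP hfi), hPm] at this
      omega
    have hmain := hP.sum_sign_crit (k := k) (by omega) hu (hXP hfi)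
    rw [hbefore, hafter, hPm, clampRank_diff hk hi, hPerase i hi, hsumErase i hi] at hmain
    have hout : ∑ q ∈ P \ X, (if (inner ℝ u (f i) : ℝ) < inner ℝ u q then (1 : ℝ)
        else -1) * crit P k (f i) q = ∑ q ∈ P \ X, crit P k (f i) q :=
      sum_congr rfl fun q hq => by rw [if_pos (hfirst _ hfi q hq), one_mul]
    have hleft : ∑ j ∈ range i, (if (inner ℝ u (f i) : ℝ) < inner ℝ u (f j) then (1 : ℝ)
        else -1) * crit P k (f i) (f j) = -∑ j ∈ range i, crit P k (f i) (f j) := by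
      rw [← sum_neg_distrib]
      refine sum_congr rfl fun j hj => ?_
      have hj' : j < i := mem_range.1 hj
      rw [if_neg (by rw [hlt i hi j (by omega)]; omega), neg_one_mul]
    have hright : ∑ j ∈ Ico (i + 1) m, (if (inner ℝ u (f i) : ℝ) < inner ℝ u (f j) then (1 : ℝ)
        else -1) * crit P k (f i) (f j) = ∑ j ∈ Ico (i + 1) m, crit P k (f i) (f j) :=
      sum_congr rfl fun j hj => by
        have hj' := mem_Ico.1 hj
        rw [if_pos ((hlt i hi j hj'.2).2 (by omega)), one_mul]
    rw [hout, hleft, hright] at hmain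
    linarith
  have hprefix : ∀ t ≤ m, ∑ i ∈ range t, ∑ j ∈ Ico t m, crit P k (f i) (f j) +
      ∑ i ∈ range t, ∑ q ∈ P \ X, crit P k (f i) q =
      ∑ i ∈ range t, 2 * ((k : ℝ) - min (i : ℝ) k) := by
    intro t ht
    rw [← sum_after_sub_before (fun i j => crit P k (f i) (f j)) (fun i j => crit_comm _ _ _ _) ht,
      ← sum_add_distrib]
    exact sum_congr rfl fun i hi => hrow i (by rw [mem_range] at hi; omega)
  refine ⟨?_, fun hmk N => ?_⟩
  -- For the full prefix the cut inside `X` is empty.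
  · rw [← hprefix m le_rfl, hsumX]
    simp
  · obtain ⟨d, hd⟩ : ∃ d, d + 2 * k + 1 = 3 * m := ⟨3 * m - (2 * k + 1), by omega⟩
    have hd' : (d : ℝ) + 2 * k + 1 = 3 * m := by exact_mod_cast hd
    have hmk' : (m : ℝ) ≤ k := by exact_mod_cast hmk
    have hsd : ((P \ X).card : ℝ) = 2 * m := by
      rw [card_sdiff_of_subset hXP, hPm, hXm]
      have : 3 * m - m = 2 * m := by omega
      rw [this]
      push_cast
      rfl
    -- At most `2 * m * t` critical pairs leave `X` from the prefix, and `t * (m - t) + 2 * m * t -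
    -- (2 * k * t - t * (t - 1)) = d * t`.
    have hcut : ∀ t ≤ m, ∑ i ∈ range t, ∑ j ∈ Ico t m, (1 - crit P k (f i) (f j)) ≤
        (d : ℝ) * t := by
      intro t ht
      have ht' : (t : ℝ) ≤ m := by exact_mod_cast ht
      have h1 := hprefix t ht
      have h2 : ∑ i ∈ range t, ∑ q ∈ P \ X, crit P k (f i) q ≤ t * (2 * m) := by
        calc _ ≤ ∑ i ∈ range t, ∑ q ∈ P \ X, (1 : ℝ) :=
              sum_le_sum fun i _ => sum_le_sum fun q _ => crit_le_one _ _ _ _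
          _ = t * (2 * m) := by simp [hsd]
      have h3 : ∑ i ∈ range t, 2 * ((k : ℝ) - min (i : ℝ) k) = 2 * k * t - t * (t - 1) := by
        clear h1 h2
        induction t with
        | zero => simp
        | succ t ih =>
          have htk : (t : ℝ) ≤ k := by push_cast at ht'; linarith
          rw [sum_range_succ, ih (by omega) (by push_cast at ht'; linarith), min_eq_left htk]
          push_cast
          ring
      simp only [sum_sub_distrib, sum_const, Nat.card_Ico, card_range, nsmul_eq_mul, mul_one]
      rw [Nat.cast_sub ht]
      have hd'' : (d : ℝ) = 3 * m - 2 * k - 1 := by linarith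
      rw [hd'']
      nlinarith
    have hmain := edges_add_sum_le (fun i j => 1 - crit P k (f i) (f j)) m d k
      (fun i j => by linarith [crit_le_one P k (f i) (f j)])
      (fun i j => by linarith [crit_nonneg P k (f i) (f j)]) hcut hd N
    have hpairs : ∑ p ∈ X, ∑ q ∈ X.erase p, crit P k p q =
        2 * ∑ j ∈ range m, ∑ i ∈ range j, crit P k (f i) (f j) := by
      rw [hsumX, sum_congr rfl fun i hi => hsumErase i (mem_range.1 hi) _, sum_add_distrib,
        two_mul]
      congr 1
      · exact sum_congr rfl fun i _ => sum_congr rfl fun j _ => crit_comm _ _ _ _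
      · rw [sum_sigma', sum_sigma']
        refine sum_nbij' (fun x => ⟨x.2, x.1⟩) (fun x => ⟨x.2, x.1⟩) ?_ ?_ ?_ ?_ ?_
        · rintro ⟨i, j⟩ h
          simp only [mem_sigma, mem_range, mem_Ico] at h ⊢
          omega
        · rintro ⟨i, j⟩ h
          simp only [mem_sigma, mem_range, mem_Ico] at h ⊢
          omega
        · intro x _; rfl
        · intro x _; rfl
        · intro x _; rfl
    have hcount : ∑ j ∈ range m, ∑ i ∈ range j, (1 : ℝ) = (m : ℝ) * (m - 1) / 2 := by
      clear * -
      induction m with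
      | zero => simp
      | succ m ih => rw [sum_range_succ, ih]; simp; ring
    simp only [sum_sub_distrib] at hmain
    rw [hcount] at hmain
    rw [hpairs]
    linarith

/-! ### Assembly of the bound from the three classes. -/

theorem choose2_nonneg (r : ℝ) : 0 ≤ choose2 r := by
  unfold choose2
  split_ifs with h
  · exact le_rfl
  · have := not_lt.1 h
    have h1 : 0 ≤ r := by linarith
    have h2 : 0 ≤ r - 1 := by linarith
    positivity

theorem sum_min_eq {k m : ℕ} (hmk : m ≤ k) :
    ∑ i ∈ Finset.range m, 2 * ((k : ℝ) - min (i : ℝ) k) = 2 * k * m - m * (m - 1) := by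
  induction m with
  | zero => simp
  | succ m ih =>
    have : (m : ℝ) ≤ k := by exact_mod_cast (Nat.le_of_succ_le hmk)
    rw [Finset.sum_range_succ, ih (by omega), min_eq_left this]
    push_cast
    ring

theorem le_sum_min {k m : ℕ} (hkm : k ≤ m) :
    (k : ℝ) * (k + 1) ≤ ∑ i ∈ Finset.range m, 2 * ((k : ℝ) - min (i : ℝ) k) := by
  calc (k : ℝ) * (k + 1) = ∑ i ∈ Finset.range k, 2 * ((k : ℝ) - min (i : ℝ) k) := by
        rw [sum_min_eq le_rfl]; ring
    _ ≤ _ := Finset.sum_le_sum_of_subset_of_nonneg (by simpa using hkm) fun i _ _ => by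
        have := min_le_right (i : ℝ) k
        linarith

theorem choose2_natCast_add_one (k : ℕ) : choose2 ((k : ℝ) + 1) = (k : ℝ) * (k + 1) / 2 := by
  rcases Nat.eq_zero_or_pos k with rfl | hk
  · simp [choose2]
  · have : (1 : ℝ) ≤ k := by exact_mod_cast hk
    rw [choose2, if_neg (by linarith)]
    ring

theorem coeff_ge {j : ℤ} (hj : 1 ≤ j) : 1 / 3 ≤ coeff j := by
  have : (1 : ℝ) ≤ j := by exact_mod_cast hj
  unfold coeff
  have h : 1 / (3 * (j : ℝ) * ((j : ℝ) + 1)) ≤ 1 / 6 := by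
    apply one_div_le_one_div_of_le (by norm_num)
    nlinarith
  linarith

/-- `P` is the disjoint union of three classes of `m` points, each of which comes first in some
direction. -/
theorem ThreeDecomposable.exists_first {P : Finset Plane} (h : ThreeDecomposable P)
    (hne : P.Nonempty) {m : ℕ} (hm : P.card = 3 * m) :
    ∃ X : Fin 3 → Finset Plane, (Finset.univ.biUnion X = P) ∧
      (∀ i j, i ≠ j → Disjoint (X i) (X j)) ∧ ∀ i, (X i).card = m ∧
      ∃ v : Plane, Set.InjOn (fun x => (inner ℝ v x : ℝ)) P ∧
        ∀ x ∈ X i, ∀ y ∈ P \ X i, (inner ℝ v x : ℝ) < inner ℝ v y := by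
  obtain ⟨A, B, C, hP, hAB, hAC, hBC, hcAB, hcBC, t, -, -, h1, h2, -⟩ := h
  have hcard : A.card + B.card + C.card = 3 * m := by
    rw [← hm, ← hP, Finset.card_union_of_disjoint, Finset.card_union_of_disjoint hAB]
    exact Finset.disjoint_union_left.2 ⟨hAC, hBC⟩
  have hmpos : 0 < m := by
    have := hne.card_pos
    omega
  have hA : A.Nonempty := Finset.card_pos.1 (by omega)
  have hB : B.Nonempty := Finset.card_pos.1 (by omega)
  have hC : C.Nonempty := Finset.card_pos.1 (by omega)
  have hmem : ∀ x, x ∈ P ↔ (x ∈ A ∨ x ∈ B) ∨ x ∈ C := by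
    intro x; rw [← hP]; simp [or_assoc]
  obtain ⟨u, hu0, huBA, huAC⟩ := h1.exists_direction hB hA hC
  obtain ⟨w, hw0, hwAB, hwBC⟩ := h2.exists_direction hA hB hC
  obtain ⟨b₀, hb₀⟩ := hB
  obtain ⟨a₀, ha₀⟩ := hA
  -- `A` is first along `w`, `B` along `u`, and `C`, last along `u`, is first along `-u`.
  have gA := exists_generic_direction P A (P \ A) hw0 (by
    intro x hx y hy
    rw [Finset.mem_sdiff, hmem] at hy
    rcases hy with ⟨(hy | hy) | hy, hn⟩
    · exact absurd hy hn
    · exact hwAB x hx y hy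
    · exact (hwAB x hx b₀ hb₀).trans (hwBC b₀ hb₀ y hy))
  have gB := exists_generic_direction P B (P \ B) hu0 (by
    intro x hx y hy
    rw [Finset.mem_sdiff, hmem] at hy
    rcases hy with ⟨(hy | hy) | hy, hn⟩
    · exact huBA x hx y hy
    · exact absurd hy hn
    · exact (huBA x hx a₀ ha₀).trans (huAC a₀ ha₀ y hy))
  have gC := exists_generic_direction P C (P \ C) (neg_ne_zero.2 hu0) (by
    intro x hx y hy
    rw [inner_neg_left, inner_neg_left, neg_lt_neg_iff]
    rw [Finset.mem_sdiff, hmem] at hy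
    rcases hy with ⟨(hy | hy) | hy, hn⟩
    · exact huAC y hy x hx
    · exact (huBA y hy a₀ ha₀).trans (huAC a₀ ha₀ x hx)
    · exact absurd hy hn)
  refine ⟨![A, B, C], ?_, ?_, ?_⟩
  · ext x
    rw [hmem]
    simp [Fin.exists_fin_succ]
    tauto
  · intro i j hij
    fin_cases i <;> fin_cases j <;> simp_all [disjoint_comm]
  · intro i
    fin_cases i
    · exact ⟨by simp; omega, gA⟩
    · exact ⟨by simp; omega, gB⟩
    · exact ⟨by simp; omega, gC⟩

theorem le_chi_of_inner_sums {P : Finset Plane} (hP : GeneralPosition P) (k : ℕ)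
    {X : Fin 3 → Finset Plane} (hX : Finset.univ.biUnion X = P)
    (hdisj : ∀ i j, i ≠ j → Disjoint (X i) (X j)) {a b : ℝ}
    (ha : ∀ i, a ≤ ∑ p ∈ X i, ∑ q ∈ P \ X i, crit P k p q)
    (hb : ∀ i, b ≤ ∑ p ∈ X i, ∑ q ∈ (X i).erase p, crit P k p q) :
    3 * (a + b) / 2 ≤ chi k P := by
  have hsub : ∀ i, X i ⊆ P := fun i => by
    rw [← hX]; exact Finset.subset_biUnion_of_mem X (Finset.mem_univ i)
  have hsum : ∑ p ∈ P, ∑ q ∈ P.erase p, crit P k p q =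
      ∑ i, (∑ p ∈ X i, ∑ q ∈ P \ X i, crit P k p q +
        ∑ p ∈ X i, ∑ q ∈ (X i).erase p, crit P k p q) := by
    conv_lhs => rw [← hX]
    rw [Finset.sum_biUnion fun i _ j _ hij => hdisj i j hij, hX]
    refine Finset.sum_congr rfl fun i _ => ?_
    rw [← Finset.sum_add_distrib]
    refine Finset.sum_congr rfl fun p hp => ?_
    have h1 := Finset.sum_erase_add P (crit P k p) (hsub i hp)
    have h2 := Finset.sum_erase_add (X i) (crit P k p) hp
    have h3 := Finset.sum_sdiff (f := crit P k p) (hsub i)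
    linarith
  have h := hP.sum_crit_le_chi k
  rw [hsum, Fin.sum_univ_three] at h
  linarith [ha 0, ha 1, ha 2, hb 0, hb 1, hb 2]

/-- For `s ≤ 2` the interval is empty and the truncation in `toNat` leaves only `F 1`. -/
theorem sum_Icc_le_sum_range (F : ℤ → ℝ) (s : ℤ) :
    F 1 + ∑ j ∈ Finset.Icc (2 : ℤ) (s - 1), F j ≤
      ∑ j ∈ Finset.range ((s - 2).toNat + 1), F ((j : ℤ) + 1) := by
  rw [Finset.sum_range_succ', add_comm]
  have : ∑ j ∈ Finset.Icc (2 : ℤ) (s - 1), F j =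
      ∑ j ∈ Finset.range (s - 2).toNat, F (((j + 1 : ℕ) : ℤ) + 1) := by
    refine Finset.sum_nbij' (fun j => (j - 2).toNat) (fun j => (j : ℤ) + 2) ?_ ?_ ?_ ?_ ?_
    · intro j hj; rw [Finset.mem_Icc] at hj; rw [Finset.mem_range]; omega
    · intro j hj; rw [Finset.mem_range] at hj; rw [Finset.mem_Icc]; omega
    · intro j hj
      rw [Finset.mem_Icc] at hj
      have : ((j - 2).toNat : ℤ) = j - 2 := Int.toNat_of_nonneg (by omega)
      rw [this]
      omega
    · intro j hj; omega
    · intro j hj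
      rw [Finset.mem_Icc] at hj
      congr 1
      have : ((j - 2).toNat : ℤ) = j - 2 := Int.toNat_of_nonneg (by omega)
      push_cast
      rw [this]
      omega
  rw [this]
  norm_num

/-- The bound holds for every value of `s`. -/
theorem bound_le_chi {n k : ℕ} {P : Finset Plane} (hn : P.card = n) (h3 : 3 ∣ n)
    (hgen : GeneralPosition P) (hdec : ThreeDecomposable P) (hk : 2 * k + 1 ≤ n) (s : ℤ) :
    B k n s ≤ chi k P := by
  obtain ⟨m, rfl⟩ := h3
  have hne : P.Nonempty := Finset.card_pos.1 (by omega)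
  obtain ⟨X, hX, hdisj, hfirst⟩ := hdec.exists_first hne hn
  have hsub : ∀ i, X i ⊆ P := fun i => by
    rw [← hX]; exact Finset.subset_biUnion_of_mem X (Finset.mem_univ i)
  have hcrit : ∀ i, _ := fun i =>
    let ⟨_, hv, hlt⟩ := (hfirst i).2
    hgen.crit_sums_of_first hn hk (hsub i) (hfirst i).1 hv hlt
  have hthird : ((3 * m : ℕ) : ℝ) / 3 = m := by push_cast; ring
  rw [B, choose2_natCast_add_one, hthird]
  -- For `k ≤ m` only the first term of `B` survives, because `c_j ≥ 1/3`, and the pairs between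
  -- classes suffice.
  rcases le_total k m with hkm | hmk
  · have hkm' : (k : ℝ) ≤ m := by exact_mod_cast hkm
    have hzero : ∀ j ∈ Finset.Icc (2 : ℤ) (s - 1), (j : ℝ) * ((j : ℝ) + 1) *
        choose2 ((k : ℝ) + 1 - coeff j * ((3 * m : ℕ) : ℝ)) = 0 := by
      intro j hj
      have := coeff_ge (j := j) (by rw [Finset.mem_Icc] at hj; omega)
      have hm0 : (0 : ℝ) ≤ ((3 * m : ℕ) : ℝ) := by positivity
      have h2 := mul_le_mul_of_nonneg_right this hm0
      have h3 : (1 / 3 : ℝ) * ((3 * m : ℕ) : ℝ) = m := by push_cast; ring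
      rw [choose2, if_pos (by linarith), mul_zero]
    rw [Finset.sum_eq_zero hzero, show choose2 ((k : ℝ) + 1 - m) = 0 from if_pos (by linarith)]
    have := le_chi_of_inner_sums hgen k hX hdisj (a := k * (k + 1)) (b := 0)
      (fun i => by rw [(hcrit i).1]; exact le_sum_min hkm)
      (fun i => Finset.sum_nonneg fun p _ => Finset.sum_nonneg fun q _ => crit_nonneg _ _ _ _)
    linarith
  · have hmk' : (m : ℝ) ≤ k := by exact_mod_cast hmk
    have hsum := sum_Icc_le_sum_range (fun j => (j : ℝ) * ((j : ℝ) + 1) *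
      choose2 ((k : ℝ) + 1 - coeff j * ((3 * m : ℕ) : ℝ))) s
    have hone : (k : ℝ) + 1 - coeff 1 * ((3 * m : ℕ) : ℝ) = k + 1 - m := by
      unfold coeff; push_cast; ring
    simp only [Int.cast_one, hone] at hsum
    set N := (s - 2).toNat + 1
    have hform : ∑ j ∈ Finset.range N, (((j : ℤ) + 1 : ℤ) : ℝ) * ((((j : ℤ) + 1 : ℤ) : ℝ) + 1) *
          choose2 ((k : ℝ) + 1 - coeff ((j : ℤ) + 1) * ((3 * m : ℕ) : ℝ)) =
        ∑ j ∈ Finset.range N, ((j : ℝ) + 1) * (j + 2) *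
          choose2 ((k : ℝ) + 1 - coeff ((j : ℤ) + 1) * ((3 * m : ℕ) : ℝ)) :=
      Finset.sum_congr rfl fun j _ => by
        congr 1
        push_cast
        ring
    rw [hform] at hsum
    have hchi := le_chi_of_inner_sums hgen k hX hdisj
      (fun i => by rw [(hcrit i).1, sum_min_eq hmk]) (fun i => (hcrit i).2 hmk N)
    -- Pairs between classes yield `3 * choose2 (k + 1) - 3 * choose2 (k + 1 - m)`; the term `j =
    -- 1`, of weight `2`, turns the minus into a plus.
    have hc : choose2 ((k : ℝ) + 1 - m) = (k - m) * (k + 1 - m) / 2 := by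
      have := choose2_natCast_add_one (k - m)
      rw [Nat.cast_sub hmk] at this
      rw [show (k : ℝ) + 1 - m = k - m + 1 by ring, this]
    rw [hc] at hsum ⊢
    linarith

/-! ### Existence and uniqueness of `s`, and the conclusion. -/

theorem choose2_le_choose2 {a b : ℤ} (h : a ≤ b) : choose2 (a : ℝ) ≤ choose2 (b : ℝ) := by
  have h' : (a : ℝ) ≤ b := by exact_mod_cast h
  by_cases ha : (a : ℝ) < 2
  · rw [choose2, if_pos ha]
    exact choose2_nonneg _
  · have := not_lt.1 ha
    rw [choose2, choose2, if_neg ha, if_neg (by linarith)]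
    nlinarith

/-- The index is the least `N` with `x ≤ choose2 (N + 1)`, where `x > 0` is the quotient;
monotonicity of `choose2` excludes larger ones, and its zero values exclude negative ones. -/
theorem existsUnique_isIndex {n k : ℕ} (hk : 2 * k + 1 < n) : ∃! s : ℤ, IsIndex k n s := by
  unfold IsIndex
  have hk' : (0 : ℝ) < (n : ℝ) - 2 * k - 1 := by
    have : (2 : ℝ) * k + 1 < n := by exact_mod_cast hk
    linarith
  have hn : (0 : ℝ) < n := by
    have : 0 < n := by omega
    exact_mod_cast this
  have hx : 0 < (n : ℝ) / (3 * ((n : ℝ) - 2 * k - 1)) := by positivity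
  generalize (n : ℝ) / (3 * ((n : ℝ) - 2 * k - 1)) = x at hx
  have hex : ∃ N : ℕ, x ≤ choose2 (((N : ℤ) : ℝ) + 1) := by
    obtain ⟨N, hN⟩ := exists_nat_ge (2 * x)
    refine ⟨N, ?_⟩
    have h1 : 1 ≤ N := by
      by_contra h
      have : N = 0 := by omega
      rw [this] at hN
      norm_num at hN
      linarith
    have h1' : (1 : ℝ) ≤ N := by exact_mod_cast h1
    rw [Int.cast_natCast, choose2_natCast_add_one]
    nlinarith
  classical
  refine ⟨(Nat.find hex : ℕ), ⟨?_, Nat.find_spec hex⟩, ?_⟩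
  · rcases Nat.eq_zero_or_pos (Nat.find hex) with h0 | hpos
    · rw [h0]
      simpa [choose2] using hx
    · have hmin := Nat.find_min hex (m := Nat.find hex - 1) (by omega)
      rw [not_le] at hmin
      rwa [Int.cast_natCast, Nat.cast_sub hpos, Nat.cast_one, sub_add_cancel] at hmin
  · rintro s ⟨hs1, hs2⟩
    have hspec := Nat.find_spec hex
    have hs0 : 0 ≤ s := by
      by_contra hneg
      have : (s : ℝ) + 1 ≤ 0 := by exact_mod_cast (by omega : s + 1 ≤ 0)
      rw [choose2, if_pos (by linarith)] at hs2
      linarith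
    lift s to ℕ using hs0
    have hle : Nat.find hex ≤ s := Nat.find_min' hex hs2
    by_contra hne
    have hlt : ((Nat.find hex : ℕ) : ℤ) + 1 ≤ (s : ℤ) := by
      have : s ≠ Nat.find hex := fun h => hne (by rw [h])
      omega
    have := choose2_le_choose2 hlt
    push_cast at this hspec hs1
    linarith

end KSets

end

theorem theorem2 (n k : ℕ) (P : Finset KSets.Plane) (hn : P.card = n) (h3 : 3 ∣ n)
    (hgen : KSets.GeneralPosition P) (hdec : KSets.ThreeDecomposable P)
    (hk : (k : ℝ) < (n : ℝ) / 2) :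
    (2 * k + 1 < n →
      (∃! s : ℤ, KSets.IsIndex k n s) ∧
        ∀ s : ℤ, KSets.IsIndex k n s → KSets.B k n s ≤ (KSets.chi k P : ℝ)) ∧
    (n = 2 * k + 1 → ∀ s : ℤ, KSets.B k n s ≤ (KSets.chi k P : ℝ)) := by
  have hk' : 2 * k + 1 ≤ n := by
    have : (2 : ℝ) * k < n := by linarith
    exact_mod_cast this
  have hbound := KSets.bound_le_chi hn h3 hgen hdec hk'
  exact ⟨fun h => ⟨KSets.existsUnique_isIndex h, fun s _ => hbound s⟩, fun _ s => hbound s⟩
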